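/- Let $(\Omega,\mathcal F,\mathbf P)$ be a probability space with a measurable bijection $\theta$ (with measurable inverse) that preserves $\mathbf P$ and is ergodic. Let $\sigma\ge 0$ (service requirement) and $\xi>0$ (inter-arrival time) be integrable random variables, and put $\sigma_n=\sigma\circ\theta^n$, $\xi_n=\xi\circ\theta^n$ for $n\in\mathbb Z$. (This is the Palm setting of a stationary ergodic marked point process of arrivals.) Let $\mathbf M$ be the set of finite counting measures $\mu=\sum_{i=1}^{N(\mu)}\delta_{\alpha_i(\mu)}$ on $[0,\infty)$, with $\alpha_1(\mu)\le\dots\le\alpha_{N(\mu)}(\mu)$ (repetitions allowed), and write $\langle\mu,I\rangle=\sum_{i}\alpha_i(\mu)$. For $y\in\mathbb R$ put $\tau_y\mu=\sum_{i:\,\alpha_i(\mu)>y}\delta_{\alpha_i(\mu)-y}$. Let $r:\{1,2,\dots\}\to\mathbb R$ be a non-increasing function with $$\sup_{n\ge 1} n\,r(n)\le 1,\qquad K_r:=\inf_{n\ge 1} n\,r(n)>0 .$$ For $\mu\in\mathbf M$ with $N(\mu)\ge 1$ and $x\ge 0$ let, for $1\le i\le N(\mu)$, $$\gamma^r_i(\mu,x)=r(N(\mu)-i+1)\Bigl(x-\sum_{j=1}^{i-1}\alpha_j(\mu)\Bigl(\frac1{r(N(\mu)-j+1)}-\frac1{r(N(\mu)-j)}\Bigr)\Bigr),$$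 $$i^r(\mu,x)=\max\{1\le i\le N(\mu):\alpha_i(\mu)\le\gamma^r_i(\mu,x)\}\quad(\max\emptyset=0),$$ $$\gamma^r(\mu,x)=\gamma^r_{\min(i^r(\mu,x)+1,\,N(\mu))}(\mu,x),\qquad \Phi^r(\mu,x)=\tau_{\gamma^r(\mu,x)}\mu .$$ Thus $\Phi^r(\mu,x)$ is the profile of remaining service times after a time $x$ without arrivals when, starting from $\mu$, each customer is served at rate $r(n)$ whenever $n$ customers are present. For an $\mathbf M$-valued random variable $\zeta$ let $\mu^{[\zeta]}_0=\zeta$ and $\mu^{[\zeta]}_{n+1}=\Phi^r(\mu^{[\zeta]}_n+\delta_{\sigma_n},\xi_n)$ for $n\ge 0$. Suppose that $\mathbf E[\sigma]<K_r\,\mathbf E[\xi]$. Then: 1. the equation $W\circ\theta=[W+\sigma-K_r\,\xi]^+$ a.s. has a real-valued random solution $W^{K_r}$, which is unique up to almost sure equality; 2. the equation $\mu\circ\theta=\Phi^r(\mu+\delta_\sigma,\xi)$ a.s. has an $\mathbf M$-valued random solution $\mu^r$, which is unique up to almost sure equality; 3. for every $\mathbf M$-valued random variable $\zeta$ with $\langle\zeta,I\rangle\le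 W^{K_r}$ a.s., the sequence $(\mu^{[\zeta]}_n)_{n\ge 0}$ converges with strong backward coupling to $\mu^r$: almost surely there is $N'(\omega)$ such that $\mu^{[\zeta]}_n(\theta^{-n}\omega)=\mu^r(\omega)$ for all $n\ge N'(\omega)$. -/

import Mathlib

open MeasureTheory

namespace ProcSharing

noncomputable section

/-- Finite counting measures on `[0, ∞)`: finite sums of Dirac masses at non-negative points.
Several unit masses may sit at the same point. -/
def IsCounting (μ : Measure ℝ) : Prop :=
  ∃ s : Multiset ℝ, (∀ a ∈ s, 0 ≤ a) ∧ μ = (s.map (fun a => Measure.dirac a)).sum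

/-- `N(μ)`, the number of atoms (with multiplicity) of a finite counting measure. -/
def numAtoms (μ : Measure ℝ) : ℕ := ⌊μ.real Set.univ⌋₊

/-- `α_i(μ)`, the `i`-th smallest atom of a counting measure, counted with multiplicity
(used for `1 ≤ i ≤ N(μ)`): the least `x` such that `μ` has at least `i` atoms in `(-∞, x]`. -/
def atom (μ : Measure ℝ) (i : ℕ) : ℝ := sInf {x : ℝ | (i : ENNReal) ≤ μ (Set.Iic x)}

/-- `τ_y μ`: translate by `-y` the part of `μ` carried by `(y, ∞)` and discard the rest. -/
def shift (y : ℝ) (μ : Measure ℝ) : Measure ℝ :=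
  (μ.restrict (Set.Ioi y)).map (fun a => a - y)

/-- `⟨μ, I⟩`, the total workload of the profile `μ`. -/
def workload (μ : Measure ℝ) : ℝ := ∫ a, a ∂μ

/-- `γ_i^r(μ, x)`, for `1 ≤ i ≤ N(μ)`. -/
def gammaAt (r : ℕ → ℝ) (μ : Measure ℝ) (x : ℝ) (i : ℕ) : ℝ :=
  r (numAtoms μ - i + 1) *
    (x - ∑ j ∈ Finset.Ico 1 i,
      atom μ j * (1 / r (numAtoms μ - j + 1) - 1 / r (numAtoms μ - j)))

/-- `i^r(μ, x) = max {1 ≤ i ≤ N(μ) : α_i(μ) ≤ γ_i^r(μ, x)}`, with `max ∅ = 0`. -/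
def lastIndex (r : ℕ → ℝ) (μ : Measure ℝ) (x : ℝ) : ℕ :=
  ((Finset.Icc 1 (numAtoms μ)).filter (fun i => atom μ i ≤ gammaAt r μ x i)).sup id

/-- `γ^r(μ, x)`: the quantity of work that each customer who is still present has received
after a time `x` without arrivals. -/
def gammaR (r : ℕ → ℝ) (μ : Measure ℝ) (x : ℝ) : ℝ :=
  gammaAt r μ x (min (lastIndex r μ x + 1) (numAtoms μ))

/-- `Φ^r(μ, x) = τ_{γ^r(μ, x)} μ`. -/
def Phi (r : ℕ → ℝ) (μ : Measure ℝ) (x : ℝ) : Measure ℝ := shift (gammaR r μ x) μ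

/-- `K_r = inf_{n ≥ 1} n r(n)`. -/
def minThroughput (r : ℕ → ℝ) : ℝ := ⨅ n : ℕ+, (n : ℝ) * r n

section Stationary

variable {Ω : Type*} [MeasurableSpace Ω]

/-- Random variables with values in the finite counting measures on `[0, ∞)`. -/
def IsRandomProfile (P : Measure Ω) (μ : Ω → Measure ℝ) : Prop :=
  Measurable μ ∧ ∀ᵐ ω ∂P, IsCounting (μ ω)

/-- The stochastically recursive sequence `X_{n+1} = φ ∘ θⁿ (X_n)`, `X_0 = Y`. -/
def srs {E : Type*} (θ : Ω ≃ᵐ Ω) (φ : Ω → E → E) (Y : Ω → E) : ℕ → Ω → E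
  | 0 => Y
  | n + 1 => fun ω => φ (θ^[n] ω) (srs θ φ Y n ω)

/-- The random map `μ ↦ Φ^r(μ + δ_σ, ξ)`. -/
def profileMap (r : ℕ → ℝ) (σ ξ : Ω → ℝ) (ω : Ω) (μ : Measure ℝ) : Measure ℝ :=
  Phi r (μ + Measure.dirac (σ ω)) (ξ ω)

/-- Finite solutions of `μ ∘ θ = Φ^r(μ + δ_σ, ξ)`. -/
def IsStationaryProfile (P : Measure Ω) (θ : Ω ≃ᵐ Ω) (r : ℕ → ℝ) (σ ξ : Ω → ℝ)
    (μ : Ω → Measure ℝ) : Prop :=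
  IsRandomProfile P μ ∧ ∀ᵐ ω ∂P, μ (θ ω) = profileMap r σ ξ ω (μ ω)

/-- Finite solutions of `W ∘ θ = [W + σ - K ξ]⁺`. -/
def IsStationaryWorkload (P : Measure Ω) (θ : Ω ≃ᵐ Ω) (K : ℝ) (σ ξ : Ω → ℝ)
    (W : Ω → ℝ) : Prop :=
  Measurable W ∧ ∀ᵐ ω ∂P, W (θ ω) = max (W ω + σ ω - K * ξ ω) 0

/-- Strong backward coupling of `(X_n)` with the stationary sequence `(Y ∘ θⁿ)`. -/
def StrongBackwardCoupling {E : Type*} (P : Measure Ω) (θ : Ω ≃ᵐ Ω) (X : ℕ → Ω → E)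
    (Y : Ω → E) : Prop :=
  ∀ᵐ ω ∂P, ∃ N : ℕ, ∀ n ≥ N, X n (θ.symm^[n] ω) = Y ω

end Stationary

end

end ProcSharing

/-! ### Finite counting measures and the shift. -/

namespace ProcSharing

/-! While `n ≥ 1` customers are present, work is done at rate `n r(n) ≥ K_r`. Hence the workload
after one step is at most `[w + σ - K_r ξ]⁺`, where `w` is the workload before it
(`workload_Phi_le`). The profile itself is not monotone in any obvious order, but its workload is a
sub-solution of Lindley's equation, and everything is controlled by the stationary solution `W`
given by Loynes's scheme.

If a profile has workload at most `W`, this persists, and on the event `W + σ - K_r ξ ≤ 0` the step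
leaves it empty. That event has positive probability, since otherwise `W` would have increments of
negative mean (`measure_idle_pos`). By ergodicity almost every backward orbit meets it. All profiles
dominated by `W` therefore agree after the most recent idle epoch, and `μ^r` is the profile rebuilt
from the empty one since then. This gives existence and coupling.

For uniqueness, the workload of any stationary profile is a stationary sub-solution, hence at most
`W` (`le_of_sub_lindley`). Coupling then applies with that profile as the initial condition. -/

lemma shift_add (y : ℝ) (μ ν : Measure ℝ) : shift y (μ + ν) = shift y μ + shift y ν := by
  unfold shift
  rw [Measure.restrict_add, Measure.map_add _ _ (by fun_prop)]

lemma shift_zero_measure (y : ℝ) : shift y 0 = 0 := by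
  simp [shift]

lemma shift_dirac (y a : ℝ) :
    shift y (Measure.dirac a) = if y < a then Measure.dirac (a - y) else 0 := by
  classical
  unfold shift
  rw [restrict_dirac' measurableSet_Ioi]
  split_ifs with h1 h2 h2
  · rw [Measure.map_dirac' (by fun_prop)]
  · exact absurd h1 h2
  · exact absurd h2 h1
  · simp

lemma IsCounting.zero : IsCounting 0 := ⟨0, by simp, by simp⟩

lemma IsCounting.add_dirac {μ : Measure ℝ} (h : IsCounting μ) {a : ℝ} (ha : 0 ≤ a) :
    IsCounting (μ + Measure.dirac a) := by
  obtain ⟨s, hs, rfl⟩ := h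
  refine ⟨a ::ₘ s, ?_, ?_⟩
  · simpa [ha] using hs
  · simp [add_comm]

lemma IsCounting.shift {μ : Measure ℝ} (h : IsCounting μ) (y : ℝ) :
    IsCounting (shift y μ) := by
  obtain ⟨s, -, rfl⟩ := h
  induction s using Multiset.induction with
  | empty => simpa [shift_zero_measure] using IsCounting.zero
  | cons a s ih =>
    rw [Multiset.map_cons, Multiset.sum_cons, add_comm, shift_add, shift_dirac]
    split_ifs with h
    · exact ih.add_dirac (by linarith)
    · simpa using ih

/-- A counting measure is the sum of the Dirac masses at its ordered atoms. -/
lemma IsCounting.exists_ordered {μ : Measure ℝ} (h : IsCounting μ) :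
    ∃ (N : ℕ) (a : ℕ → ℝ), (∀ j < N, 0 ≤ a j) ∧ (∀ i j, i ≤ j → j < N → a i ≤ a j) ∧
      μ = ∑ j ∈ Finset.range N, Measure.dirac (a j) := by
  obtain ⟨s, hs, rfl⟩ := h
  set l := s.sort (· ≤ ·) with hl
  have hls : (l : Multiset ℝ) = s := Multiset.sort_eq _ _
  refine ⟨l.length, fun j => l.getD j 0, ?_, ?_, ?_⟩
  · intro j hj
    beta_reduce
    rw [List.getD_eq_getElem _ _ hj]
    exact hs _ (by rw [← hls]; simp)
  · intro i j hij hj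
    beta_reduce
    rw [List.getD_eq_getElem _ _ hj, List.getD_eq_getElem _ _ (hij.trans_lt hj)]
    exact (Multiset.pairwise_sort s (· ≤ ·)).sortedLE.monotone_get
      (a := ⟨i, hij.trans_lt hj⟩) (b := ⟨j, hj⟩) hij
  · rw [← hls, Multiset.map_coe, Multiset.sum_coe, Finset.sum_range]
    rw [← List.sum_ofFn]
    congr 1
    apply List.ext_getElem <;> simp

/-! ### Explicit formulas in terms of the ordered atoms, indexed from `0`. -/

section Ordered

variable {N : ℕ} {a : ℕ → ℝ}

lemma numAtoms_sum_dirac : numAtoms (∑ j ∈ Finset.range N, Measure.dirac (a j)) = N := by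
  simp [numAtoms, Measure.real]

lemma sum_dirac_Iic (x : ℝ) :
    (∑ j ∈ Finset.range N, Measure.dirac (a j)) (Set.Iic x) =
      ((Finset.range N).filter (fun j => a j ≤ x)).card := by
  simp [Measure.finsetSum_apply, Measure.dirac_apply' _ measurableSet_Iic, Set.indicator_apply]

lemma atom_sum_dirac (hmono : ∀ i j, i ≤ j → j < N → a i ≤ a j) {i : ℕ} (hi : i < N) :
    atom (∑ j ∈ Finset.range N, Measure.dirac (a j)) (i + 1) = a i := by
  have : {x : ℝ | ((i + 1 : ℕ) : ENNReal) ≤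
      (∑ j ∈ Finset.range N, Measure.dirac (a j)) (Set.Iic x)} = Set.Ici (a i) := by
    ext x
    rw [Set.mem_ofPred_eq, sum_dirac_Iic, Nat.cast_le, Set.mem_Ici]
    constructor
    · intro h
      by_contra! hx
      have : (Finset.range N).filter (fun j => a j ≤ x) ⊆ Finset.range i := by
        intro j hj
        rw [Finset.mem_filter, Finset.mem_range] at hj
        rw [Finset.mem_range]
        by_contra! hij
        linarith [hmono i j hij hj.1, hj.2]
      have := Finset.card_le_card this
      rw [Finset.card_range] at this
      omega
    · intro h
      have : Finset.range (i + 1) ⊆ (Finset.range N).filter (fun j => a j ≤ x) := by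
        intro j hj
        rw [Finset.mem_range] at hj
        rw [Finset.mem_filter, Finset.mem_range]
        exact ⟨by omega, (hmono j i (by omega) hi).trans h⟩
      simpa using Finset.card_le_card this
  rw [atom, this, csInf_Ici]

lemma gammaAt_sum_dirac (hmono : ∀ i j, i ≤ j → j < N → a i ≤ a j) (r : ℕ → ℝ) (x : ℝ) {i : ℕ}
    (hi : i < N) :
    gammaAt r (∑ j ∈ Finset.range N, Measure.dirac (a j)) x (i + 1) =
      r (N - i) * (x - ∑ j ∈ Finset.range i, a j * (1 / r (N - j) - 1 / r (N - (j + 1)))) := by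
  unfold gammaAt
  rw [numAtoms_sum_dirac, Finset.sum_Ico_eq_sum_range, show N - (i + 1) + 1 = N - i by omega]
  congr 2
  refine Finset.sum_congr (by simp) fun j hj => ?_
  have hj : j < i := by simpa using hj
  rw [add_comm 1 j, atom_sum_dirac hmono (by omega), show N - (j + 1) + 1 = N - j by omega]

lemma workload_sum_dirac :
    workload (∑ j ∈ Finset.range N, Measure.dirac (a j)) = ∑ j ∈ Finset.range N, a j := by
  unfold workload
  rw [integral_finsetSum_measure fun j _ => integrable_dirac (by simp)]
  simp

lemma workload_shift_sum_dirac (y : ℝ) :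
    workload (shift y (∑ j ∈ Finset.range N, Measure.dirac (a j))) =
      ∑ j ∈ Finset.range N, max (a j - y) 0 := by
  unfold workload shift
  rw [integral_map (by fun_prop) (by fun_prop), ← integral_indicator measurableSet_Ioi,
    integral_finsetSum_measure fun j _ => integrable_dirac (by simp)]
  refine Finset.sum_congr rfl fun j _ => ?_
  rw [integral_dirac, Set.indicator_apply]
  split_ifs with h
  · rw [max_eq_left]; linarith [Set.mem_Ioi.1 h]
  · rw [max_eq_right]; linarith [not_lt.1 (Set.mem_Ioi.not.1 h)]

/-- The work done up to the attained service `γ` is at least `K` times the time elapsed. -/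
lemma mul_time_le_work {c : ℕ → ℝ} {K : ℝ} (hc : ∀ m, 1 ≤ m → K * c m ≤ m)
    (ha : ∀ j < N, 0 ≤ a j) (hmono : ∀ i j, i ≤ j → j < N → a i ≤ a j) (i : ℕ) (hi : i < N)
    (γ : ℝ) (h0 : i = 0 → 0 ≤ γ) (hγ : ∀ j < i, a j ≤ γ) :
    K * (γ * c (N - i) + ∑ j ∈ Finset.range i, a j * (c (N - j) - c (N - (j + 1)))) ≤
      ∑ j ∈ Finset.range i, a j + (N - i : ℕ) * γ := by
  induction i generalizing γ with
  | zero =>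
    have := mul_le_mul_of_nonneg_right (hc N (by omega)) (h0 rfl)
    simp only [Finset.range_zero, Finset.sum_empty, tsub_zero]
    linarith
  | succ i ih =>
    -- Stop at attained service `a i`, when customer `i` leaves. From there to `γ`, `N - (i + 1)`
    -- customers remain, each unit of service taking time `c (N - (i + 1))`.
    have h1 := ih (by omega) (a i) (fun _ => ha i (by omega))
      (fun j hj => hmono j i hj.le (by omega))
    have h2 := mul_le_mul_of_nonneg_right (hc (N - (i + 1)) (by omega))
      (sub_nonneg.2 (hγ i (by omega)))
    rw [Finset.sum_range_succ, Finset.sum_range_succ]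
    have h3 : ((N - i : ℕ) : ℝ) = (N - (i + 1) : ℕ) + 1 := by
      rw [← Nat.cast_add_one]; congr 1; omega
    rw [h3] at h1
    nlinarith

end Ordered

/-! ### The workload bound for one step. -/

lemma le_mul_of_pos_minThroughput {r : ℕ → ℝ} (hr_pos : 0 < minThroughput r) {n : ℕ}
    (hn : 1 ≤ n) : minThroughput r ≤ n * r n := by
  have hb : BddBelow (Set.range fun n : ℕ+ => (n : ℝ) * r n) := by
    -- A real infimum over a set unbounded below is `0` by convention, so positivity rules this out.
    by_contra h
    exact hr_pos.ne' (Real.iInf_of_not_bddBelow h)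
  exact ciInf_le hb ⟨n, hn⟩

lemma rate_pos {r : ℕ → ℝ} (hr_pos : 0 < minThroughput r) {n : ℕ} (hn : 1 ≤ n) : 0 < r n := by
  have h := hr_pos.trans_le (le_mul_of_pos_minThroughput hr_pos hn)
  exact (pos_iff_pos_of_mul_pos h).1 (by exact_mod_cast hn)

lemma lastIndex_le (r : ℕ → ℝ) (μ : Measure ℝ) (x : ℝ) : lastIndex r μ x ≤ numAtoms μ := by
  refine Finset.sup_le fun i hi => ?_
  simp only [Finset.mem_filter, Finset.mem_Icc] at hi
  exact hi.1.2

lemma lastIndex_spec {r : ℕ → ℝ} {μ : Measure ℝ} {x : ℝ} (h : lastIndex r μ x ≠ 0) :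
    atom μ (lastIndex r μ x) ≤ gammaAt r μ x (lastIndex r μ x) := by
  have hne : ((Finset.Icc 1 (numAtoms μ)).filter
      (fun i => atom μ i ≤ gammaAt r μ x i)).Nonempty := by
    by_contra hne
    rw [Finset.not_nonempty_iff_eq_empty] at hne
    exact h (by simp [lastIndex, hne])
  obtain ⟨i, hi, hi'⟩ := Finset.exists_mem_eq_sup _ hne id
  have : lastIndex r μ x = i := hi'
  rw [this]
  exact (Finset.mem_filter.1 hi).2

lemma gammaAt_lt_atom_of_lastIndex_lt {r : ℕ → ℝ} {μ : Measure ℝ} {x : ℝ} {i : ℕ}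
    (h : lastIndex r μ x < i) (hi : i ≤ numAtoms μ) : gammaAt r μ x i < atom μ i := by
  by_contra! hle
  have : id i ≤ lastIndex r μ x := Finset.le_sup (f := id) (by
    simp only [Finset.mem_filter, Finset.mem_Icc]
    exact ⟨⟨by omega, hi⟩, hle⟩)
  simp only [id] at this
  omega

/-- While it is not empty, the system works at rate at least `K_r`. -/
theorem workload_Phi_le {r : ℕ → ℝ} (hr_pos : 0 < minThroughput r) {μ : Measure ℝ}
    (hμ : IsCounting μ) {x : ℝ} (hx : 0 ≤ x) :
    workload (Phi r μ x) ≤ max (workload μ - minThroughput r * x) 0 := by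
  obtain ⟨N, a, ha, hmono, rfl⟩ := hμ.exists_ordered
  set μ := ∑ j ∈ Finset.range N, Measure.dirac (a j) with hμdef
  have hN : numAtoms μ = N := numAtoms_sum_dirac
  rw [Phi, workload_shift_sum_dirac, workload_sum_dirac]
  set i := lastIndex r μ x with hi
  have hiN : i ≤ N := hN ▸ lastIndex_le r μ x
  -- If `i = N`, everyone has left and the new workload is `0`. Otherwise `γ` is the service
  -- attained by the customers still present.
  rcases hiN.eq_or_lt with h | h
  · refine le_max_of_le_right (Finset.sum_nonpos fun j hj => ?_)
    have hj : j < N := Finset.mem_range.1 hj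
    have h1 : atom μ i ≤ gammaAt r μ x i := lastIndex_spec (by omega)
    have h2 : gammaR r μ x = gammaAt r μ x i := by
      rw [gammaR, hN, ← hi]; congr 1; omega
    obtain ⟨k, hk⟩ : ∃ k, i = k + 1 := ⟨i - 1, by omega⟩
    rw [hk, atom_sum_dirac hmono (by omega), ← hk, ← h2] at h1
    rw [max_le_iff]
    refine ⟨?_, le_rfl⟩
    linarith [hmono j k (by omega) (by omega)]
  · refine le_max_of_le_left ?_
    have h2 : gammaR r μ x = gammaAt r μ x (i + 1) := by
      rw [gammaR, hN, ← hi]; congr 1; omega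
    have h3 : gammaAt r μ x (i + 1) < atom μ (i + 1) :=
      gammaAt_lt_atom_of_lastIndex_lt (by omega) (by omega)
    rw [← h2, atom_sum_dirac hmono h] at h3
    set γ := gammaR r μ x with hγ
    have hform := gammaAt_sum_dirac hmono r x h
    rw [← hμdef, ← h2] at hform
    have hri : 0 < r (N - i) := rate_pos hr_pos (by omega)
    -- The known inequality compares `a k` with its own `γ`, computed at rate `r (N - k)`. It says
    -- that customer `k` leaves by time `x`, and so does `a k ≤ γ`: the term `j = k` of the sum
    -- converts one rate into the next.
    have hγle : ∀ j < i, a j ≤ γ := by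
      intro j hj
      obtain ⟨k, hk⟩ : ∃ k, i = k + 1 := ⟨i - 1, by omega⟩
      have h1 : atom μ i ≤ gammaAt r μ x i := lastIndex_spec (by omega)
      rw [hk, atom_sum_dirac hmono (by omega), gammaAt_sum_dirac hmono r x (by omega)] at h1
      refine (hmono j k (by omega) (by omega)).trans ?_
      rw [hk, Finset.sum_range_succ, ← hk] at hform
      have hrk : 0 < r (N - k) := rate_pos hr_pos (by omega)
      rw [← div_le_iff₀' hrk] at h1
      rw [hform, ← div_le_iff₀' hri]
      have e1 : a k * (1 / r (N - k)) = a k / r (N - k) := by ring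
      have e2 : a k * (1 / r (N - i)) = a k / r (N - i) := by ring
      rw [mul_sub, e1, e2]
      linarith
    have hγ0 : i = 0 → 0 ≤ γ := by
      intro h0
      rw [hform, h0]
      simpa using mul_nonneg (rate_pos hr_pos (by omega : 1 ≤ N)).le hx
    have key := mul_time_le_work (c := fun m => 1 / r m) (K := minThroughput r)
      (fun m hm => by
        have := le_mul_of_pos_minThroughput hr_pos hm
        rw [mul_one_div, div_le_iff₀ (rate_pos hr_pos hm)]
        exact this) ha hmono i h γ hγ0 hγle
    -- Inverting the formula for `γ`: the time needed to reach attained service `γ` is `x`.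
    have htime : γ * (1 / r (N - i)) + ∑ j ∈ Finset.range i,
        a j * (1 / r (N - j) - 1 / r (N - (j + 1))) = x := by
      rw [hform]; field_simp; ring
    simp only [htime] at key
    have hsplit : ∀ f : ℕ → ℝ, ∑ j ∈ Finset.range N, f j =
        ∑ j ∈ Finset.range i, f j + ∑ j ∈ Finset.Ico i N, f j :=
      fun f => (Finset.sum_range_add_sum_Ico f h.le).symm
    rw [hsplit, hsplit a]
    have e1 : ∑ j ∈ Finset.range i, max (a j - γ) 0 = 0 := by
      refine Finset.sum_eq_zero fun j hj => max_eq_right ?_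
      linarith [hγle j (Finset.mem_range.1 hj)]
    have e2 : ∑ j ∈ Finset.Ico i N, max (a j - γ) 0 =
        ∑ j ∈ Finset.Ico i N, a j - (N - i : ℕ) * γ := by
      rw [Finset.sum_congr rfl (g := fun j => a j - γ), Finset.sum_sub_distrib]
      · simp
      · intro j hj
        rw [Finset.mem_Ico] at hj
        refine max_eq_left ?_
        linarith [hmono i j hj.1 hj.2]
    rw [e1, e2]
    linarith

/-- The shift keeps only strictly positive atoms. A general counting measure could have zero
workload and atoms at `0`. -/
lemma shift_eq_zero_of_workload_nonpos {μ : Measure ℝ} (hμ : IsCounting μ) {y : ℝ}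
    (h : workload (shift y μ) ≤ 0) : shift y μ = 0 := by
  obtain ⟨N, a, -, -, rfl⟩ := hμ.exists_ordered
  rw [workload_shift_sum_dirac] at h
  have h0 := (Finset.sum_eq_zero_iff_of_nonneg (fun j _ => le_max_right (a j - y) 0)).1
    (h.antisymm (Finset.sum_nonneg fun j _ => le_max_right _ _))
  have hr : (∑ j ∈ Finset.range N, Measure.dirac (a j)) (Set.Ioi y) = 0 := by
    rw [Measure.finsetSum_apply]
    refine Finset.sum_eq_zero fun j hj => ?_
    rw [Measure.dirac_apply' _ measurableSet_Ioi, Set.indicator_of_notMem]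
    have := h0 j hj
    rw [max_eq_right_iff] at this
    simpa using this
  rw [shift, Measure.restrict_eq_zero.2 hr, Measure.map_zero]

/-- This form is visibly measurable in the measure. -/
lemma workload_eq_toReal_lintegral {μ : Measure ℝ} (hμ : IsCounting μ) :
    workload μ = (∫⁻ a, ENNReal.ofReal a ∂μ).toReal := by
  obtain ⟨N, a, ha, -, rfl⟩ := hμ.exists_ordered
  rw [workload_sum_dirac, lintegral_finsetSum_measure]
  simp only [lintegral_dirac]
  rw [ENNReal.toReal_sum (by simp)]
  exact Finset.sum_congr rfl fun j hj =>
    (ENNReal.toReal_ofReal (ha j (Finset.mem_range.1 hj))).symm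

lemma workload_add_dirac {μ : Measure ℝ} (hμ : IsCounting μ) (s : ℝ) :
    workload (μ + Measure.dirac s) = workload μ + s := by
  obtain ⟨N, a, -, -, rfl⟩ := hμ.exists_ordered
  unfold workload
  rw [integral_add_measure
    (integrable_finsetSum_measure.2 fun j _ => integrable_dirac (by simp))
    (integrable_dirac (by simp)), integral_dirac]

end ProcSharing

/-! ### Lindley's equation and ergodic arguments. -/

open Filter Topology

namespace ProcSharing

variable {Ω : Type*} [MeasurableSpace Ω] {P : Measure Ω} [IsProbabilityMeasure P] {θ : Ω ≃ᵐ Ω}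

lemma ae_mem_or_ae_notMem_of_subset_preimage (hθ : Ergodic θ P) {A : Set Ω}
    (hA : MeasurableSet A) (h : A ≤ᵐ[P] θ ⁻¹' A) :
    (∀ᵐ ω ∂P, ω ∈ A) ∨ ∀ᵐ ω ∂P, ω ∉ A := by
  rcases hθ.ae_empty_or_univ_of_ae_le_preimage hA.nullMeasurableSet h with h | h
  · exact Or.inr (measure_eq_zero_iff_ae_notMem.1 (ae_eq_empty.1 h))
  · exact Or.inl (mem_ae_iff.2 (ae_eq_univ.1 h))

/-- If a non-negative variable has stationary increments bounded above by the integrable `Z`,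
then `Z` has a non-negative mean. -/
lemma integral_nonneg_of_increment_le (hθ : MeasurePreserving θ P P) {Y Z : Ω → ℝ}
    (hY : Measurable Y) (hY0 : ∀ᵐ ω ∂P, 0 ≤ Y ω) (hZ : Integrable Z P)
    (h : ∀ᵐ ω ∂P, Y (θ ω) ≤ Y ω + Z ω) : 0 ≤ ∫ ω, Z ω ∂P := by
  -- `Y` need not be integrable, so it is truncated: `min Y n` has increments of mean zero, bounded
  -- above by `Z` on `Y ≤ n` and by `0` elsewhere.
  have hlim : Tendsto (fun n : ℕ => ∫ ω, Set.indicator {ω | Y ω ≤ n} Z ω ∂P) atTop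
      (𝓝 (∫ ω, Z ω ∂P)) := by
    refine tendsto_integral_of_dominated_convergence (fun ω => |Z ω|)
      (fun n => hZ.aestronglyMeasurable.indicator (measurableSet_le hY measurable_const))
      hZ.abs (fun n => Eventually.of_forall fun ω => ?_) (Eventually.of_forall fun ω => ?_)
    · rw [Set.indicator_apply]
      split_ifs <;> simp
    · refine tendsto_const_nhds.congr' ?_
      obtain ⟨m, hm⟩ := exists_nat_ge (Y ω)
      filter_upwards [eventually_ge_atTop m] with n hn
      rw [Set.indicator_of_mem]
      exact hm.trans (by exact_mod_cast hn)
  refine ge_of_tendsto' hlim fun n => ?_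
  have hint : Integrable (fun ω => min (Y ω) n) P := by
    refine Integrable.of_bound (C := n) (by fun_prop) ?_
    filter_upwards [hY0] with ω h0
    rw [Real.norm_eq_abs, abs_of_nonneg (le_min h0 (Nat.cast_nonneg n))]
    exact min_le_right _ _
  have hint' : Integrable (fun ω => min (Y (θ ω)) n) P :=
    (hθ.integrable_comp_emb θ.measurableEmbedding (g := fun ω => min (Y ω) n)).2 hint
  have heq : ∫ ω, min (Y (θ ω)) n ∂P = ∫ ω, min (Y ω) n ∂P :=
    hθ.integral_comp θ.measurableEmbedding (fun ω => min (Y ω) (n : ℝ))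
  have h0 : ∫ ω, (min (Y (θ ω)) n - min (Y ω) n) ∂P = 0 := by
    rw [integral_sub hint' hint, heq, sub_self]
  rw [← h0]
  refine integral_mono_ae (hint'.sub hint)
    (hZ.indicator (measurableSet_le hY measurable_const)) ?_
  filter_upwards [h] with ω hω
  rw [Set.indicator_apply]
  split_ifs with hn
  · have hn : Y ω ≤ n := hn
    rw [min_eq_left hn]
    linarith [min_le_left (Y (θ ω)) (n : ℝ)]
  · have hn : (n : ℝ) < Y ω := not_le.1 hn
    rw [min_eq_right hn.le]
    linarith [min_le_right (Y (θ ω)) (n : ℝ)]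

omit [IsProbabilityMeasure P] in
lemma nonneg_of_lindley (hθ : MeasurePreserving θ P P) {W Z : Ω → ℝ} (hW : Measurable W)
    (h : ∀ᵐ ω ∂P, W (θ ω) = max (W ω + Z ω) 0) : ∀ᵐ ω ∂P, 0 ≤ W ω := by
  have h1 : ∀ᵐ ω ∂P, 0 ≤ W (θ ω) := by
    filter_upwards [h] with ω hω
    rw [hω]; exact le_max_right _ _
  have : ∀ᵐ ω ∂(P.map θ), 0 ≤ W ω :=
    (ae_map_iff hθ.measurable.aemeasurable (measurableSet_le measurable_const hW)).2 h1
  rwa [hθ.map_eq] at this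

/-- A stationary solution of Lindley's equation dominates all stationary sub-solutions. -/
lemma le_of_sub_lindley (hθ : Ergodic θ P) {Y W Z : Ω → ℝ} (hY : Measurable Y)
    (hW : Measurable W) (hZ : Integrable Z P) (hneg : ∫ ω, Z ω ∂P < 0)
    (hYeq : ∀ᵐ ω ∂P, Y (θ ω) ≤ max (Y ω + Z ω) 0)
    (hWeq : ∀ᵐ ω ∂P, W (θ ω) = max (W ω + Z ω) 0) : ∀ᵐ ω ∂P, Y ω ≤ W ω := by
  have hms : MeasurableSet {ω | Y ω ≤ W ω} := measurableSet_le hY hW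
  have hsub : {ω | Y ω ≤ W ω} ≤ᵐ[P] θ ⁻¹' {ω | Y ω ≤ W ω} := by
    filter_upwards [hYeq, hWeq] with ω h1 h2 h3
    have h3 : Y ω ≤ W ω := h3
    change Y (θ ω) ≤ W (θ ω)
    rw [h2]
    exact h1.trans (max_le_max_right 0 (by linarith))
  rcases ae_mem_or_ae_notMem_of_subset_preimage hθ hms hsub with h | h
  · exact h
  -- Here `Y > W ≥ 0` almost surely, so the positive part never acts on `Y` and its increments are
  -- at most `Z`.
  · exfalso
    have hlt : ∀ᵐ ω ∂P, W ω < Y ω := by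
      filter_upwards [h] with ω hω using not_le.1 hω
    have hW0 := nonneg_of_lindley hθ.toMeasurePreserving hW hWeq
    have hlt' : ∀ᵐ ω ∂P, W (θ ω) < Y (θ ω) := hθ.quasiMeasurePreserving.ae hlt
    refine hneg.not_ge (integral_nonneg_of_increment_le hθ.toMeasurePreserving hY
      (by filter_upwards [hlt, hW0] with ω h1 h2 using h2.trans h1.le) hZ ?_)
    filter_upwards [hYeq, hWeq, hlt'] with ω h1 h2 h3
    have h4 : 0 < Y (θ ω) := lt_of_le_of_lt (h2 ▸ le_max_right _ _) h3
    rcases le_max_iff.1 h1 with h5 | h5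
    · exact h5
    · exact absurd h5 h4.not_ge

/-- Loynes's sequence: the workload at time `0` of the queue that was empty at time `-n`. -/
def loynes (θ : Ω ≃ᵐ Ω) (Z : Ω → ℝ) : ℕ → Ω → ℝ
  | 0 => fun _ => 0
  | n + 1 => fun ω => max (loynes θ Z n (θ.symm ω) + Z (θ.symm ω)) 0

lemma loynes_succ (Z : Ω → ℝ) (n : ℕ) (ω : Ω) :
    loynes θ Z (n + 1) (θ ω) = max (loynes θ Z n ω + Z ω) 0 := by
  simp [loynes]

lemma loynes_nonneg (Z : Ω → ℝ) (n : ℕ) (ω : Ω) : 0 ≤ loynes θ Z n ω := by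
  cases n with
  | zero => exact le_rfl
  | succ n => exact le_max_right _ _

lemma loynes_mono (Z : Ω → ℝ) (ω : Ω) : Monotone fun n => loynes θ Z n ω := by
  have : ∀ n ω, loynes θ Z n ω ≤ loynes θ Z (n + 1) ω := by
    intro n
    induction n with
    | zero => exact fun ω => loynes_nonneg Z 1 ω
    | succ n ih => exact fun ω => max_le_max_right 0 (by linarith [ih (θ.symm ω)])
  exact monotone_nat_of_le_succ fun n => this n ω

lemma loynes_measurable {Z : Ω → ℝ} (hZ : Measurable Z) (n : ℕ) :
    Measurable (loynes θ Z n) := by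
  induction n with
  | zero => exact measurable_const
  | succ n ih =>
    exact ((ih.comp θ.symm.measurable).add (hZ.comp θ.symm.measurable)).max measurable_const

omit [IsProbabilityMeasure P] in
lemma loynes_integrable (hθ : MeasurePreserving θ P P) {Z : Ω → ℝ}
    (hZ : Integrable Z P) (n : ℕ) : Integrable (loynes θ Z n) P := by
  induction n with
  | zero => exact integrable_zero _ _ _
  | succ n ih =>
    have := (hθ.symm θ).integrable_comp_of_integrable (ih.add hZ).pos_part
    exact this

/-- Boundedness is an invariant event. If it were null, the sequence `M_n` would increase to
infinity and `M_{n+1} ∘ θ - M_n = max Z (-M_n)` would tend to `Z`. These differences have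
non-negative mean, which contradicts the negative mean of `Z`. -/
lemma bddAbove_loynes (hθ : Ergodic θ P) {Z : Ω → ℝ} (hZm : Measurable Z)
    (hZ : Integrable Z P) (hneg : ∫ ω, Z ω ∂P < 0) :
    ∀ᵐ ω ∂P, BddAbove (Set.range fun n => loynes θ Z n ω) := by
  have hms : MeasurableSet {ω | BddAbove (Set.range fun n => loynes θ Z n ω)} :=
    measurableSet_bddAbove_range fun n => loynes_measurable hZm n
  have hsub : {ω | BddAbove (Set.range fun n => loynes θ Z n ω)} ⊆
      θ ⁻¹' {ω | BddAbove (Set.range fun n => loynes θ Z n ω)} := by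
    rintro ω ⟨C, hC⟩
    refine ⟨max (C + Z ω) 0, ?_⟩
    rintro _ ⟨n, rfl⟩
    cases n with
    | zero => exact le_max_right _ _
    | succ n =>
      change loynes θ Z (n + 1) (θ ω) ≤ _
      rw [loynes_succ]
      exact max_le_max_right 0 (by linarith [hC ⟨n, rfl⟩])
  rcases ae_mem_or_ae_notMem_of_subset_preimage hθ hms
    (Eventually.of_forall fun _ h => hsub h) with h | h
  · exact h
  · exfalso
    have hlim : Tendsto (fun n : ℕ => ∫ ω, max (Z ω) (-loynes θ Z n ω) ∂P) atTop
        (𝓝 (∫ ω, Z ω ∂P)) := by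
      refine tendsto_integral_of_dominated_convergence (fun ω => |Z ω|)
        (fun n => (hZm.max (loynes_measurable hZm n).neg).aestronglyMeasurable)
        hZ.abs (fun n => Eventually.of_forall fun ω => ?_) ?_
      · rw [Real.norm_eq_abs, abs_le]
        exact ⟨(neg_abs_le _).trans (le_max_left _ _), max_le (le_abs_self _)
          ((neg_nonpos.2 (loynes_nonneg Z n ω)).trans (abs_nonneg _))⟩
      · filter_upwards [h] with ω hω
        refine tendsto_const_nhds.congr' ?_
        filter_upwards [(tendsto_atTop_atTop_of_monotone' (loynes_mono Z ω)
          hω).eventually_ge_atTop (-Z ω)] with n hn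
        rw [max_eq_left]; linarith
    refine hneg.not_ge (ge_of_tendsto' hlim fun n => ?_)
    have hint := loynes_integrable hθ.toMeasurePreserving hZ n
    have hint1 := loynes_integrable hθ.toMeasurePreserving hZ (n + 1)
    have hintθ : Integrable (fun ω => loynes θ Z (n + 1) (θ ω)) P :=
      hθ.toMeasurePreserving.integrable_comp_of_integrable hint1
    have heq : ∫ ω, loynes θ Z (n + 1) (θ ω) ∂P = ∫ ω, loynes θ Z (n + 1) ω ∂P :=
      hθ.toMeasurePreserving.integral_comp θ.measurableEmbedding _
    have : ∫ ω, max (Z ω) (-loynes θ Z n ω) ∂P =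
        ∫ ω, loynes θ Z (n + 1) ω ∂P - ∫ ω, loynes θ Z n ω ∂P := by
      rw [← heq, ← integral_sub hintθ hint]
      congr 1
      ext ω
      rw [loynes_succ, ← max_sub_sub_right]
      congr 1 <;> ring
    rw [this, sub_nonneg]
    exact integral_mono hint hint1 fun ω => loynes_mono Z ω n.le_succ

/-- Loynes's theorem: existence of a stationary solution of Lindley's equation. -/
theorem exists_stationary_lindley (hθ : Ergodic θ P) {Z : Ω → ℝ} (hZm : Measurable Z)
    (hZ : Integrable Z P) (hneg : ∫ ω, Z ω ∂P < 0) :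
    ∃ W : Ω → ℝ, Measurable W ∧ ∀ᵐ ω ∂P, W (θ ω) = max (W ω + Z ω) 0 := by
  have hb := bddAbove_loynes hθ hZm hZ hneg
  have hbθ := hθ.quasiMeasurePreserving.ae hb
  refine ⟨fun ω => ⨆ n, loynes θ Z n ω, Measurable.iSup fun n => loynes_measurable hZm n, ?_⟩
  filter_upwards [hb, hbθ] with ω h1 h2
  have t1 := tendsto_atTop_ciSup (loynes_mono Z ω) h1
  have t2 := (tendsto_atTop_ciSup (loynes_mono Z (θ ω)) h2).comp (tendsto_add_atTop_nat 1)
  refine tendsto_nhds_unique t2 (((t1.add_const (Z ω)).max tendsto_const_nhds).congr fun n => ?_)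
  exact (loynes_succ Z n ω).symm

/-- Without reflection at `0`, the non-negative `W` would have stationary increments exactly `Z`, of
negative mean. -/
lemma measure_idle_pos (hθ : Ergodic θ P) {W Z : Ω → ℝ} (hW : Measurable W)
    (hZ : Integrable Z P) (hneg : ∫ ω, Z ω ∂P < 0)
    (hWeq : ∀ᵐ ω ∂P, W (θ ω) = max (W ω + Z ω) 0) : P {ω | W ω + Z ω ≤ 0} ≠ 0 := by
  intro h0
  have h0 : ∀ᵐ ω ∂P, ¬ (W ω + Z ω ≤ 0) := by
    rw [ae_iff]; simpa only [not_not] using h0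
  refine hneg.not_ge (integral_nonneg_of_increment_le hθ.toMeasurePreserving hW
    (nonneg_of_lindley hθ.toMeasurePreserving hW hWeq) hZ ?_)
  filter_upwards [h0, hWeq] with ω h1 h2
  rw [h2, max_eq_left (not_le.1 h1).le]

/-- Almost every backward orbit of an ergodic automorphism meets a set of positive measure. -/
lemma ae_exists_symm_iterate_mem (hθ : Ergodic θ P) {A : Set Ω} (hA : MeasurableSet A)
    (hpos : P A ≠ 0) : ∀ᵐ ω ∂P, ∃ n : ℕ, θ.symm^[n + 1] ω ∈ A := by
  have hset : {ω | ∃ n : ℕ, θ.symm^[n + 1] ω ∈ A} = ⋃ n : ℕ, θ.symm^[n + 1] ⁻¹' A := by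
    ext ω; simp
  have hms : MeasurableSet {ω | ∃ n : ℕ, θ.symm^[n + 1] ω ∈ A} := by
    rw [hset]
    exact MeasurableSet.iUnion fun n => θ.symm.measurable.iterate (n + 1) hA
  have hsub : {ω | ∃ n : ℕ, θ.symm^[n + 1] ω ∈ A} ⊆
      θ ⁻¹' {ω | ∃ n : ℕ, θ.symm^[n + 1] ω ∈ A} := by
    rintro ω ⟨n, hn⟩
    refine ⟨n + 1, ?_⟩
    rw [Function.iterate_succ_apply, θ.symm_apply_apply]
    exact hn
  rcases ae_mem_or_ae_notMem_of_subset_preimage hθ hms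
    (Eventually.of_forall fun _ h => hsub h) with h | h
  · exact h
  · exfalso
    refine hpos ?_
    rw [← (hθ.toMeasurePreserving.symm θ).measure_preimage hA.nullMeasurableSet]
    refine measure_mono_null ?_ (measure_eq_zero_iff_ae_notMem.2 h)
    exact fun ω hω => ⟨0, hω⟩

end ProcSharing

/-! ### Measurability of the profiles started from the empty one. -/

namespace ProcSharing

variable {Ω : Type*} [MeasurableSpace Ω]

lemma measurable_atom {m : Ω → Measure ℝ} (hm : Measurable m)
    (hb : ∀ ω, ∃ b : ℝ, m ω (Set.Iic b) = 0) {i : ℕ} (hi : 1 ≤ i) :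
    Measurable fun ω => atom (m ω) i := by
  have hmeas : ∀ x : ℝ, MeasurableSet {ω | (i : ENNReal) ≤ m ω (Set.Iic x)} := fun x =>
    measurableSet_le measurable_const ((Measure.measurable_coe measurableSet_Iic).comp hm)
  refine measurable_of_Iio fun c => ?_
  -- The second event is where the defining set is empty, so that its `sInf` is `0` by convention.
  have hset : (fun ω => atom (m ω) i) ⁻¹' Set.Iio c =
      (⋃ q : ℚ, {ω | (q : ℝ) < c} ∩ {ω | (i : ENNReal) ≤ m ω (Set.Iic (q : ℝ))}) ∪
        ((⋂ n : ℕ, {ω | (i : ENNReal) ≤ m ω (Set.Iic (n : ℝ))}ᶜ) ∩ {ω | 0 < c}) := by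
    ext ω
    simp only [Set.mem_preimage, Set.mem_Iio, Set.mem_union, Set.mem_iUnion, Set.mem_inter_iff,
      Set.mem_ofPred_eq, Set.mem_iInter, Set.mem_compl_iff]
    obtain ⟨b, hb⟩ := hb ω
    have hbdd : BddBelow {x : ℝ | (i : ENNReal) ≤ m ω (Set.Iic x)} := by
      refine ⟨b, fun x hx => ?_⟩
      by_contra! hlt
      have h1 : (i : ENNReal) ≤ m ω (Set.Iic x) := hx
      have h2 := h1.trans (measure_mono (Set.Iic_subset_Iic.2 hlt.le))
      rw [hb] at h2
      have : i = 0 := by simpa using h2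
      omega
    rcases Set.eq_empty_or_nonempty {x : ℝ | (i : ENNReal) ≤ m ω (Set.Iic x)} with he | hne
    · have hno : ∀ x : ℝ, ¬ (i : ENNReal) ≤ m ω (Set.Iic x) := fun x hx => by
        have : x ∈ {x : ℝ | (i : ENNReal) ≤ m ω (Set.Iic x)} := hx
        rw [he] at this
        exact this
      simp [atom, hno]
    · obtain ⟨x, hx⟩ := hne
      obtain ⟨n, hn⟩ := exists_nat_ge x
      have hex : ¬ ∀ n : ℕ, ¬ (i : ENNReal) ≤ m ω (Set.Iic (n : ℝ)) := fun h =>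
        h n (le_trans hx (measure_mono (Set.Iic_subset_Iic.2 hn)))
      rw [atom, csInf_lt_iff hbdd ⟨x, hx⟩]
      simp only [hex, false_and, or_false]
      constructor
      · rintro ⟨y, hy, hyc⟩
        obtain ⟨q, hq1, hq2⟩ := exists_rat_btwn hyc
        exact ⟨q, hq2, le_trans hy (measure_mono (Set.Iic_subset_Iic.2 hq1.le))⟩
      · rintro ⟨q, hq, hq'⟩
        exact ⟨q, hq', hq⟩
  rw [hset]
  exact (MeasurableSet.iUnion fun q : ℚ => (MeasurableSet.const _).inter (hmeas q)).union
    ((MeasurableSet.iInter fun n : ℕ => (hmeas n).compl).inter (MeasurableSet.const _))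

lemma measurable_numAtoms {m : Ω → Measure ℝ} (hm : Measurable m) :
    Measurable fun ω => numAtoms (m ω) :=
  Nat.measurable_floor.comp
    ((Measure.measurable_coe MeasurableSet.univ).comp hm).ennreal_toReal

lemma measurable_gammaAt (r : ℕ → ℝ) {m : Ω → Measure ℝ} (hm : Measurable m)
    (hb : ∀ ω, ∃ b : ℝ, m ω (Set.Iic b) = 0) {x : Ω → ℝ} (hx : Measurable x) (i : ℕ) :
    Measurable fun ω => gammaAt r (m ω) (x ω) i := by
  have hN := measurable_numAtoms hm
  have hr : ∀ g : ℕ → ℝ, Measurable fun ω => g (numAtoms (m ω)) := fun g =>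
    (measurable_of_countable g).comp hN
  unfold gammaAt
  refine (hr fun n => r (n - i + 1)).mul (hx.sub (Finset.measurable_sum _ fun j hj => ?_))
  exact (measurable_atom hm hb (Finset.mem_Ico.1 hj).1).mul
    (hr fun n => 1 / r (n - j + 1) - 1 / r (n - j))

lemma measurable_lastIndex (r : ℕ → ℝ) {m : Ω → Measure ℝ} (hm : Measurable m)
    (hb : ∀ ω, ∃ b : ℝ, m ω (Set.Iic b) = 0) {x : Ω → ℝ} (hx : Measurable x) :
    Measurable fun ω => lastIndex r (m ω) (x ω) := by
  refine measurable_of_Iic fun k => ?_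
  have hset : (fun ω => lastIndex r (m ω) (x ω)) ⁻¹' Set.Iic k =
      ⋂ i : ℕ, ⋂ _ : k < i, ({ω | i ≤ numAtoms (m ω)} ∩
        {ω | atom (m ω) i ≤ gammaAt r (m ω) (x ω) i})ᶜ := by
    ext ω
    simp only [Set.mem_preimage, Set.mem_Iic, lastIndex, Finset.sup_le_iff, Finset.mem_filter,
      Finset.mem_Icc, id, Set.mem_iInter, Set.mem_compl_iff, Set.mem_inter_iff,
      Set.mem_ofPred_eq]
    constructor
    · intro h i hki hi
      have := h i ⟨⟨by omega, hi.1⟩, hi.2⟩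
      omega
    · intro h i hi
      by_contra! hki
      exact h i hki ⟨hi.1.2, hi.2⟩
  rw [hset]
  refine MeasurableSet.iInter fun i => MeasurableSet.iInter fun hi => ?_
  exact ((measurableSet_le measurable_const (measurable_numAtoms hm)).inter
    (measurableSet_le (measurable_atom hm hb (by omega)) (measurable_gammaAt r hm hb hx i))).compl

lemma measurable_apply_nat_index {f : ℕ → Ω → ℝ} (hf : ∀ n, Measurable (f n)) {k : Ω → ℕ}
    (hk : Measurable k) : Measurable fun ω => f (k ω) ω :=
  (measurable_from_prod_countable_left (f := fun p : Ω × ℕ => f p.2 p.1) hf).comp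
    (measurable_id.prodMk hk)

lemma measurable_gammaR (r : ℕ → ℝ) {m : Ω → Measure ℝ} (hm : Measurable m)
    (hb : ∀ ω, ∃ b : ℝ, m ω (Set.Iic b) = 0) {x : Ω → ℝ} (hx : Measurable x) :
    Measurable fun ω => gammaR r (m ω) (x ω) := by
  have hk : Measurable fun ω => lastIndex r (m ω) (x ω) + 1 :=
    (measurable_of_countable fun n : ℕ => n + 1).comp (measurable_lastIndex r hm hb hx)
  exact measurable_apply_nat_index (f := fun n ω => gammaAt r (m ω) (x ω) n)
    (measurable_gammaAt r hm hb hx) (hk.min (measurable_numAtoms hm))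

/-- Random measures that are finite sums of Dirac masses at random points, each one present on
a measurable event. -/
inductive IsSimpleProfile : (Ω → Measure ℝ) → Prop
  | zero : IsSimpleProfile fun _ => 0
  | add_dirac {m : Ω → Measure ℝ} {s : Ω → ℝ} {A : Set Ω} :
      IsSimpleProfile m → Measurable s → MeasurableSet A →
      IsSimpleProfile fun ω => m ω + A.indicator (fun ω => Measure.dirac (s ω)) ω

namespace IsSimpleProfile

variable {m : Ω → Measure ℝ}

lemma measurable (h : IsSimpleProfile m) : Measurable m := by
  induction h with
  | zero => exact measurable_const
  | add_dirac _ hs hA ih =>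
    have h1 := (Measure.measurable_dirac.comp hs).indicator hA
    refine Measure.measurable_of_measurable_coe _ fun B hB => ?_
    exact ((Measure.measurable_coe hB).comp ih).add ((Measure.measurable_coe hB).comp h1)

lemma exists_Iic_eq_zero (h : IsSimpleProfile m) (ω : Ω) : ∃ b : ℝ, m ω (Set.Iic b) = 0 := by
  classical
  induction h with
  | zero => exact ⟨0, rfl⟩
  | @add_dirac m s A _ _ _ ih =>
    obtain ⟨b, hb⟩ := ih
    refine ⟨min b (s ω - 1), ?_⟩
    rw [Measure.add_apply, measure_mono_null (Set.Iic_subset_Iic.2 (min_le_left _ _)) hb,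
      zero_add, Set.indicator_apply]
    split_ifs
    · rw [Measure.dirac_apply' _ measurableSet_Iic, Set.indicator_of_notMem]
      simp
    · rfl

/-- Each random atom is translated and its presence event is cut by `y < s`. Staying in this class
avoids proving that the shift is jointly measurable in the level and the measure. -/
lemma shift (h : IsSimpleProfile m) {y : Ω → ℝ} (hy : Measurable y) :
    IsSimpleProfile fun ω => shift (y ω) (m ω) := by
  induction h with
  | zero => simpa only [shift_zero_measure] using IsSimpleProfile.zero
  | @add_dirac m s A _ hs hA ih =>
    have := ih.add_dirac (hs.sub hy) (hA.inter (measurableSet_lt hy hs))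
    convert this using 2 with ω
    rw [shift_add]
    congr 1
    by_cases h1 : ω ∈ A
    · by_cases h2 : y ω < s ω <;> simp [h1, h2, shift_dirac]
    · simp [h1, shift_zero_measure]

lemma profileMap (h : IsSimpleProfile m) (r : ℕ → ℝ) {σ ξ : Ω → ℝ} (hσ : Measurable σ)
    (hξ : Measurable ξ) (T : Ω → Ω) (hT : Measurable T) :
    IsSimpleProfile fun ω => profileMap r σ ξ (T ω) (m ω) := by
  have h1 : IsSimpleProfile fun ω => m ω + Measure.dirac (σ (T ω)) := by
    simpa using h.add_dirac (hσ.comp hT) MeasurableSet.univ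
  exact h1.shift (measurable_gammaR r h1.measurable h1.exists_Iic_eq_zero (hξ.comp hT))

lemma srs (θ : Ω ≃ᵐ Ω) (r : ℕ → ℝ) {σ ξ : Ω → ℝ} (hσ : Measurable σ) (hξ : Measurable ξ)
    (n : ℕ) :
    IsSimpleProfile (ProcSharing.srs θ (ProcSharing.profileMap r σ ξ) (fun _ => 0) n) := by
  induction n with
  | zero => exact IsSimpleProfile.zero
  | succ n ih => exact ih.profileMap r hσ hξ _ (θ.measurable.iterate n)

end IsSimpleProfile

end ProcSharing

/-! ### Backward coupling at idle epochs. -/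

namespace ProcSharing

section
variable {Ω : Type*} [MeasurableSpace Ω] {θ : Ω ≃ᵐ Ω}

lemma srs_symm_iterate_succ {E : Type*} (φ : Ω → E → E) (Y : Ω → E) (n : ℕ) (ω : Ω) :
    srs θ φ Y (n + 1) (θ.symm^[n + 1] (θ ω)) = φ ω (srs θ φ Y n (θ.symm^[n] ω)) := by
  rw [Function.iterate_succ_apply, θ.symm_apply_apply, srs]
  beta_reduce
  rw [(Function.LeftInverse.iterate θ.apply_symm_apply n) ω]

lemma srs_symm_iterate_succ' {E : Type*} (φ : Ω → E → E) (Y : Ω → E) (n : ℕ) (ω : Ω) :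
    srs θ φ Y (n + 1) (θ.symm^[n + 1] ω) =
      φ (θ.symm ω) (srs θ φ Y n (θ.symm^[n] (θ.symm ω))) := by
  have h := srs_symm_iterate_succ (θ := θ) φ Y n (θ.symm ω)
  rwa [θ.apply_symm_apply] at h

lemma ae_symm_iterate {P : Measure Ω} (hθ : MeasurePreserving θ P P) {p : Ω → Prop}
    (h : ∀ᵐ ω ∂P, p ω) : ∀ᵐ ω ∂P, ∀ n : ℕ, p (θ.symm^[n] ω) :=
  ae_all_iff.2 fun n => ((hθ.symm θ).iterate n).quasiMeasurePreserving.ae h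

/-- The pointwise properties of the input at `ω` used by the coupling argument. -/
structure RegularInput (θ : Ω ≃ᵐ Ω) (K : ℝ) (σ ξ W : Ω → ℝ) (ω : Ω) : Prop where
  service_nonneg : 0 ≤ σ ω
  interarrival_nonneg : 0 ≤ ξ ω
  workload_nonneg : 0 ≤ W ω
  workload_step : W (θ ω) = max (W ω + (σ ω - K * ξ ω)) 0

variable {r : ℕ → ℝ} {σ ξ W : Ω → ℝ} {ω : Ω}

omit [MeasurableSpace Ω] in
lemma workload_profileMap_le (hr_pos : 0 < minThroughput r) {μ : Measure ℝ} (hμ : IsCounting μ)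
    (hσ : 0 ≤ σ ω) (hξ : 0 ≤ ξ ω) :
    workload (profileMap r σ ξ ω μ) ≤
      max (workload μ + (σ ω - minThroughput r * ξ ω)) 0 := by
  have h := workload_Phi_le hr_pos (hμ.add_dirac hσ) hξ
  rwa [workload_add_dirac hμ, add_sub_assoc] at h

omit [MeasurableSpace Ω] in
lemma IsCounting.profileMap {μ : Measure ℝ} (hμ : IsCounting μ) (hσ : 0 ≤ σ ω) :
    IsCounting (profileMap r σ ξ ω μ) :=
  (hμ.add_dirac hσ).shift _

namespace RegularInput

lemma workload_le (hr_pos : 0 < minThroughput r)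
    (h : RegularInput θ (minThroughput r) σ ξ W ω) {μ : Measure ℝ} (hμ : IsCounting μ)
    (hle : workload μ ≤ W ω) : workload (profileMap r σ ξ ω μ) ≤ W (θ ω) := by
  rw [h.workload_step]
  exact (workload_profileMap_le hr_pos hμ h.service_nonneg h.interarrival_nonneg).trans
    (max_le_max_right 0 (by linarith))

/-- At an idle epoch the dominating workload `W (θ ω)` is `0`. -/
lemma profileMap_eq_zero (hr_pos : 0 < minThroughput r)
    (h : RegularInput θ (minThroughput r) σ ξ W ω) {μ : Measure ℝ} (hμ : IsCounting μ)
    (hle : workload μ ≤ W ω) (hidle : W ω + (σ ω - minThroughput r * ξ ω) ≤ 0) :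
    profileMap r σ ξ ω μ = 0 := by
  refine shift_eq_zero_of_workload_nonpos (hμ.add_dirac h.service_nonneg) ?_
  have := h.workload_le hr_pos hμ hle
  rwa [h.workload_step, max_eq_right hidle] at this

end RegularInput

lemma srs_backward_bounds (hr_pos : 0 < minThroughput r) {ζ : Ω → Measure ℝ} (n : ℕ)
    (h : ∀ k, RegularInput θ (minThroughput r) σ ξ W (θ.symm^[k] ω))
    (hζ : ∀ k, IsCounting (ζ (θ.symm^[k] ω)) ∧ workload (ζ (θ.symm^[k] ω)) ≤ W (θ.symm^[k] ω)) :
    IsCounting (srs θ (profileMap r σ ξ) ζ n (θ.symm^[n] ω)) ∧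
      workload (srs θ (profileMap r σ ξ) ζ n (θ.symm^[n] ω)) ≤ W ω := by
  induction n generalizing ω with
  | zero => exact hζ 0
  | succ n ih =>
    obtain ⟨h1, h2⟩ := ih (ω := θ.symm ω) (fun k => h (k + 1)) (fun k => hζ (k + 1))
    have h0 : RegularInput θ (minThroughput r) σ ξ W (θ.symm ω) := h 1
    rw [srs_symm_iterate_succ']
    refine ⟨h1.profileMap h0.service_nonneg, ?_⟩
    have := h0.workload_le hr_pos h1 h2
    rwa [θ.apply_symm_apply] at this

/-- After an idle epoch, the profile no longer depends on the initial one. -/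
lemma srs_backward_coupling (hr_pos : 0 < minThroughput r) {ζ : Ω → Measure ℝ} (k : ℕ)
    (h : ∀ k, RegularInput θ (minThroughput r) σ ξ W (θ.symm^[k] ω))
    (hζ : ∀ k, IsCounting (ζ (θ.symm^[k] ω)) ∧ workload (ζ (θ.symm^[k] ω)) ≤ W (θ.symm^[k] ω))
    (hk : θ.symm^[k + 1] ω ∈ {ω | W ω + (σ ω - minThroughput r * ξ ω) ≤ 0}) (n : ℕ)
    (hn : k + 1 ≤ n) :
    srs θ (profileMap r σ ξ) ζ n (θ.symm^[n] ω) =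
      srs θ (profileMap r σ ξ) (fun _ => 0) k (θ.symm^[k] ω) := by
  -- For `k = 0` the last step empties the profile. For larger `k`, peel off the last step, common
  -- to both sides, and move `ω` back by one.
  induction k generalizing ω n with
  | zero =>
    obtain ⟨n, rfl⟩ : ∃ m, n = m + 1 := ⟨n - 1, by omega⟩
    obtain ⟨h1, h2⟩ := srs_backward_bounds (ω := θ.symm ω) hr_pos n (fun k => h (k + 1))
      (fun k => hζ (k + 1))
    rw [srs_symm_iterate_succ']
    exact (h 1).profileMap_eq_zero hr_pos h1 h2 hk
  | succ k ih =>
    obtain ⟨n, rfl⟩ : ∃ m, n = m + 1 := ⟨n - 1, by omega⟩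
    rw [srs_symm_iterate_succ', srs_symm_iterate_succ',
      ih (ω := θ.symm ω) (fun k => h (k + 1)) (fun k => hζ (k + 1)) hk n (by omega)]

end

-- The solution is the profile obtained from the empty one over the `k` steps since the most recent
-- idle epoch `-(k + 1)`. Its equation follows by coupling the sequence started empty at both `ω`
-- and `θ ω`.
open scoped Classical in
theorem exists_stationary_profile {Ω : Type*} [MeasurableSpace Ω]
    (P : Measure Ω) [IsProbabilityMeasure P] (θ : Ω ≃ᵐ Ω) (hθ : Ergodic θ P)
    (σ ξ W : Ω → ℝ) (hσ_meas : Measurable σ) (hξ_meas : Measurable ξ)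
    (r : ℕ → ℝ) (hr_pos : 0 < minThroughput r) (hW : Measurable W)
    (hreg : ∀ᵐ ω ∂P, RegularInput θ (minThroughput r) σ ξ W ω)
    (hidle : P {ω | W ω + (σ ω - minThroughput r * ξ ω) ≤ 0} ≠ 0) :
    ∃ μ : Ω → Measure ℝ, IsStationaryProfile P θ r σ ξ μ ∧
      ∀ ζ : Ω → Measure ℝ, IsRandomProfile P ζ → (∀ᵐ ω ∂P, workload (ζ ω) ≤ W ω) →
        StrongBackwardCoupling P θ (srs θ (profileMap r σ ξ) ζ) μ := by
  set A := {ω | W ω + (σ ω - minThroughput r * ξ ω) ≤ 0} with hAdef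
  have hA : MeasurableSet A :=
    measurableSet_le (hW.add (hσ_meas.sub (measurable_const.mul hξ_meas))) measurable_const
  have hAk : ∀ k : ℕ, MeasurableSet {ω | θ.symm^[k + 1] ω ∈ A} := fun k =>
    θ.symm.measurable.iterate (k + 1) hA
  -- The second alternative, almost surely excluded, makes the search for `k` succeed at every `ω`,
  -- as `Measurable.find` requires.
  set p : ℕ → Ω → Prop := fun k ω =>
    θ.symm^[k + 1] ω ∈ A ∨ ∀ j : ℕ, ¬ θ.symm^[j + 1] ω ∈ A with hp
  have hpm : ∀ k, MeasurableSet {ω | p k ω} := by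
    intro k
    have hset : {ω | p k ω} =
        {ω | θ.symm^[k + 1] ω ∈ A} ∪ ⋂ j : ℕ, {ω | θ.symm^[j + 1] ω ∈ A}ᶜ := by
      ext ω
      simp only [hp, Set.mem_ofPred_eq, Set.mem_union, Set.mem_iInter, Set.mem_compl_iff]
    rw [hset]
    exact (hAk k).union (MeasurableSet.iInter fun j => (hAk j).compl)
  have hpe : ∀ ω, ∃ k, p k ω := by
    intro ω
    by_cases h : ∃ k : ℕ, θ.symm^[k + 1] ω ∈ A
    · exact h.imp fun k hk => Or.inl hk
    · exact ⟨0, Or.inr (not_exists.1 h)⟩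
  set V : ℕ → Ω → Measure ℝ := fun k ω =>
    srs θ (profileMap r σ ξ) (fun _ => 0) k (θ.symm^[k] ω) with hV
  have hVm : ∀ k, Measurable (V k) := fun k =>
    (IsSimpleProfile.srs θ r hσ_meas hξ_meas k).measurable.comp (θ.symm.measurable.iterate k)
  have hreg' := ae_symm_iterate hθ.toMeasurePreserving hreg
  have hret := ae_exists_symm_iterate_mem hθ hA hidle
  have hfind : ∀ ω, (∃ k : ℕ, θ.symm^[k + 1] ω ∈ A) →
      θ.symm^[Nat.find (hpe ω) + 1] ω ∈ A := fun ω ⟨k, hk⟩ =>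
    (Nat.find_spec (hpe ω)).resolve_right fun h => h k hk
  have hzero : ∀ ω, (∀ k, RegularInput θ (minThroughput r) σ ξ W (θ.symm^[k] ω)) →
      ∀ k : ℕ, IsCounting (0 : Measure ℝ) ∧ workload (0 : Measure ℝ) ≤ W (θ.symm^[k] ω) :=
    fun ω h k => ⟨IsCounting.zero, by simpa [workload] using (h k).workload_nonneg⟩
  have hcouple : ∀ ζ : Ω → Measure ℝ, (∀ᵐ ω ∂P, IsCounting (ζ ω)) →
      (∀ᵐ ω ∂P, workload (ζ ω) ≤ W ω) →
        StrongBackwardCoupling P θ (srs θ (profileMap r σ ξ) ζ)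
          (fun ω => V (Nat.find (hpe ω)) ω) := by
    intro ζ hζ hζW
    filter_upwards [hreg', hret, ae_symm_iterate hθ.toMeasurePreserving (hζ.and hζW)]
      with ω h1 h2 h3
    exact ⟨_, srs_backward_coupling hr_pos _ h1 h3 (hfind ω h2)⟩
  refine ⟨fun ω => V (Nat.find (hpe ω)) ω, ⟨⟨Measurable.find hVm hpm hpe, ?_⟩, ?_⟩,
    fun ζ hζ hζW => hcouple ζ hζ.2 hζW⟩
  · filter_upwards [hreg'] with ω h1
    exact (srs_backward_bounds hr_pos _ h1 (hzero ω h1)).1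
  · have hc : StrongBackwardCoupling P θ (srs θ (profileMap r σ ξ) fun _ => 0)
        (fun ω => V (Nat.find (hpe ω)) ω) := by
      refine hcouple _ (Eventually.of_forall fun _ => IsCounting.zero) ?_
      filter_upwards [hreg'] with ω h1 using (hzero ω h1 0).2
    have hc' := hθ.quasiMeasurePreserving.ae hc
    filter_upwards [hc, hc'] with ω h1 h2
    obtain ⟨N, hN⟩ := h1
    obtain ⟨N', hN'⟩ := h2
    -- One more step is taken at `θ ω`, so that both trajectories start at the same past instant.
    rw [← hN (max N N') (le_max_left _ _), ← hN' (max N N' + 1) (by omega),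
      srs_symm_iterate_succ]

lemma workload_le_of_isStationaryProfile {Ω : Type*} [MeasurableSpace Ω]
    {P : Measure Ω} [IsProbabilityMeasure P] {θ : Ω ≃ᵐ Ω} (hθ : Ergodic θ P)
    {σ ξ W : Ω → ℝ} {r : ℕ → ℝ} (hr_pos : 0 < minThroughput r) (hW : Measurable W)
    (hreg : ∀ᵐ ω ∂P, RegularInput θ (minThroughput r) σ ξ W ω)
    (hZ : Integrable (fun ω => σ ω - minThroughput r * ξ ω) P)
    (hneg : ∫ ω, (σ ω - minThroughput r * ξ ω) ∂P < 0)
    {ν : Ω → Measure ℝ} (hν : IsStationaryProfile P θ r σ ξ ν) :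
    ∀ᵐ ω ∂P, workload (ν ω) ≤ W ω := by
  have hY : Measurable fun ω => (∫⁻ a, ENNReal.ofReal a ∂(ν ω)).toReal :=
    ((Measure.measurable_lintegral ENNReal.measurable_ofReal).comp hν.1.1).ennreal_toReal
  have hcount := hν.1.2
  have hcountθ := hθ.quasiMeasurePreserving.ae hcount
  have h := le_of_sub_lindley hθ hY hW hZ hneg ?_ (hreg.mono fun ω h => h.workload_step)
  · filter_upwards [h, hcount] with ω h1 h2
    rwa [workload_eq_toReal_lintegral h2]
  · filter_upwards [hν.2, hcount, hcountθ, hreg] with ω h1 h2 h3 h4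
    rw [← workload_eq_toReal_lintegral h2, ← workload_eq_toReal_lintegral h3, h1]
    exact workload_profileMap_le hr_pos h2 h4.service_nonneg h4.interarrival_nonneg

/-- A stationary solution used as initial condition reproduces itself, so coupling it with another
one forces equality. -/
lemma ae_srs_backward_eq {Ω E : Type*} [MeasurableSpace Ω] {P : Measure Ω} {θ : Ω ≃ᵐ Ω}
    (hθ : MeasurePreserving θ P P) {φ : Ω → E → E} {Y : Ω → E}
    (h : ∀ᵐ ω ∂P, Y (θ ω) = φ ω (Y ω)) :
    ∀ᵐ ω ∂P, ∀ n : ℕ, srs θ φ Y n (θ.symm^[n] ω) = Y ω := by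
  filter_upwards [ae_symm_iterate hθ h] with ω hω n
  induction n generalizing ω with
  | zero => rfl
  | succ n ih =>
    have h1 : Y (θ (θ.symm ω)) = φ (θ.symm ω) (Y (θ.symm ω)) := hω 1
    rw [srs_symm_iterate_succ', ih _ fun k => hω (k + 1), ← h1, θ.apply_symm_apply]

end ProcSharing

theorem mainTheorem2 {Ω : Type*} [MeasurableSpace Ω]
    (P : Measure Ω) [IsProbabilityMeasure P] (θ : Ω ≃ᵐ Ω) (hθ : Ergodic θ P)
    (σ ξ : Ω → ℝ) (hσ_meas : Measurable σ) (hξ_meas : Measurable ξ)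
    (hσ_nonneg : ∀ᵐ ω ∂P, 0 ≤ σ ω) (hξ_pos : ∀ᵐ ω ∂P, 0 < ξ ω)
    (hσ_int : Integrable σ P) (hξ_int : Integrable ξ P)
    (r : ℕ → ℝ) (hr_anti : ∀ i j : ℕ, 1 ≤ i → i ≤ j → r j ≤ r i)
    (hr_le : ∀ n : ℕ, 1 ≤ n → (n : ℝ) * r n ≤ 1)
    (hr_pos : 0 < ProcSharing.minThroughput r)
    (hload : ∫ ω, σ ω ∂P < ProcSharing.minThroughput r * ∫ ω, ξ ω ∂P) :
    ∃ W : Ω → ℝ,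
      ProcSharing.IsStationaryWorkload P θ (ProcSharing.minThroughput r) σ ξ W ∧
      (∀ W' : Ω → ℝ,
        ProcSharing.IsStationaryWorkload P θ (ProcSharing.minThroughput r) σ ξ W' →
          ∀ᵐ ω ∂P, W' ω = W ω) ∧
      ∃ μ : Ω → Measure ℝ,
        ProcSharing.IsStationaryProfile P θ r σ ξ μ ∧
        (∀ ν : Ω → Measure ℝ,
          ProcSharing.IsStationaryProfile P θ r σ ξ ν → ∀ᵐ ω ∂P, ν ω = μ ω) ∧
        ∀ ζ : Ω → Measure ℝ, ProcSharing.IsRandomProfile P ζ →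
          (∀ᵐ ω ∂P, ProcSharing.workload (ζ ω) ≤ W ω) →
          ProcSharing.StrongBackwardCoupling P θ
            (ProcSharing.srs θ (ProcSharing.profileMap r σ ξ) ζ) μ := by
  have hZ : Integrable (fun ω => σ ω - ProcSharing.minThroughput r * ξ ω) P :=
    hσ_int.sub (hξ_int.const_mul _)
  have hZm : Measurable fun ω => σ ω - ProcSharing.minThroughput r * ξ ω :=
    hσ_meas.sub (measurable_const.mul hξ_meas)
  have hneg : ∫ ω, (σ ω - ProcSharing.minThroughput r * ξ ω) ∂P < 0 := by
    rw [integral_sub hσ_int (hξ_int.const_mul _), integral_const_mul]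
    linarith
  obtain ⟨W, hW, hWeq⟩ := ProcSharing.exists_stationary_lindley hθ hZm hZ hneg
  have hreg : ∀ᵐ ω ∂P,
      ProcSharing.RegularInput θ (ProcSharing.minThroughput r) σ ξ W ω := by
    filter_upwards [hσ_nonneg, hξ_pos,
      ProcSharing.nonneg_of_lindley hθ.toMeasurePreserving hW hWeq, hWeq] with ω h1 h2 h3 h4
    exact ⟨h1, h2.le, h3, h4⟩
  obtain ⟨μ, hμ, hcouple⟩ := ProcSharing.exists_stationary_profile P θ hθ σ ξ W hσ_meas hξ_meas
    r hr_pos hW hreg (ProcSharing.measure_idle_pos hθ hW hZ hneg hWeq)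
  refine ⟨W, ⟨hW, ?_⟩, ?_, μ, hμ, ?_, hcouple⟩
  · filter_upwards [hWeq] with ω h
    rw [h, add_sub_assoc]
  · rintro W' ⟨hW', hWeq'⟩
    have hWeq' : ∀ᵐ ω ∂P,
        W' (θ ω) = max (W' ω + (σ ω - ProcSharing.minThroughput r * ξ ω)) 0 := by
      filter_upwards [hWeq'] with ω h
      rw [h, add_sub_assoc]
    -- Each solution is in particular a sub-solution, so each dominates the other.
    filter_upwards [ProcSharing.le_of_sub_lindley hθ hW' hW hZ hneg
        (hWeq'.mono fun _ h => h.le) hWeq,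
      ProcSharing.le_of_sub_lindley hθ hW hW' hZ hneg (hWeq.mono fun _ h => h.le) hWeq']
      with ω h1 h2 using le_antisymm h1 h2
  · intro ν hν
    filter_upwards [hcouple ν hν.1 (ProcSharing.workload_le_of_isStationaryProfile hθ hr_pos hW
      hreg hZ hneg hν), ProcSharing.ae_srs_backward_eq hθ.toMeasurePreserving hν.2]
      with ω ⟨N, hN⟩ h2
    rw [← hN N le_rfl, h2]
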